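/- Let $\kappa$ be an uncountable regular cardinal. If every $\kappa$-Knaster partial order is $\kappa$-stationarily layered, then $\square(\kappa)$ fails. Here the following definitions are used. Two elements of a partial order $\mathbb{P}$ are compatible if they have a common lower bound in $\mathbb{P}$; an antichain of $\mathbb{P}$ is a set of pairwise incompatible elements. The partial order $\mathbb{P}$ is $\kappa$-Knaster if every set of $\kappa$-many elements of $\mathbb{P}$ contains a subset of cardinality $\kappa$ consisting of pairwise compatible elements. A suborder $\mathbb{Q}\subseteq\mathbb{P}$ is regular if any two elements of $\mathbb{Q}$ that are incompatible in $\mathbb{Q}$ are incompatible in $\mathbb{P}$, and every maximal antichain of $\mathbb{Q}$ is a maximal antichain of $\mathbb{P}$. For a set $A$, let $\mathcal{P}_\kappa(A)$ be the collection of all subsets of $A$ of cardinality less than $\kappa$; a subset of $\mathcal{P}_\kappa(A)$ is stationary in $\mathcal{P}_\kappa(A)$ if it meets every $\mathcal{C}\subseteq\mathcal{P}_\kappa(A)$ that is cofinal in $\mathcal{P}_\kappa(A)$ with respect to $\subseteq$ and closed under unions of nonempty $\subseteq$-chains of cardinality less than $\kappa$. The partial order $\mathbb{P}$ is $\kappa$-stationarily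 layered if the collection of all regular suborders of $\mathbb{P}$ of cardinality less than $\kappa$ is stationary in $\mathcal{P}_\kappa(\mathbb{P})$. For a set $C$ of ordinals, let $\mathrm{acc}(C)$ be the set of all $\beta\in C$ with $\beta\neq 0$ such that $C\cap\beta$ is unbounded in $\beta$; in particular, $\mathrm{acc}(\kappa)$ is the set of all limit ordinals $0<\alpha<\kappa$. Then $\square(\kappa)$ is the statement that there is a sequence $\langle C_\alpha\mid\alpha<\kappa\rangle$ such that (1) $C_\alpha$ is a closed unbounded subset of $\alpha$ for all $\alpha\in\mathrm{acc}(\kappa)$; (2) if $\alpha,\beta\in\mathrm{acc}(\kappa)$ and $\alpha\in\mathrm{acc}(C_\beta)$, then $C_\alpha=C_\beta\cap\alpha$; (3) there is no closed unbounded subset $D$ of $\kappa$ such that $D\cap\alpha=C_\alpha$ for all $\alpha\in\mathrm{acc}(D)$. -/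

import Mathlib

open Set
open scoped Cardinal

universe u

/-! ### The principle `□(κ)` -/

/-- `acc(C)`: the set of those `β ∈ C` that are limit points of `C`, that is, `β ≠ 0` and `C ∩ β`
is unbounded in `β`. For `C = Iio κ.ord` this is the set of all limit ordinals below `κ`. -/
def accPoints (C : Set Ordinal.{u}) : Set Ordinal.{u} :=
  {β | β ∈ C ∧ β ≠ 0 ∧ ∀ γ < β, ∃ δ ∈ C, γ < δ ∧ δ < β}

/-- `C` is a club subset of the ordinal `α` (identified with the set of smaller ordinals). -/
def IsClubIn (C : Set Ordinal.{u}) (α : Ordinal.{u}) : Prop :=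
  C ⊆ Iio α ∧ IsClub ((fun β : Iio α => (β : Ordinal.{u})) ⁻¹' C)

/-- `⟨C α | α < κ⟩` is a `□(κ)`-sequence. The values `C α` for `α ∉ acc(κ)` play no role. -/
structure IsSquareSeq (κ : Cardinal.{u}) (C : Ordinal.{u} → Set Ordinal.{u}) : Prop where
  club : ∀ α ∈ accPoints (Iio κ.ord), IsClubIn (C α) α
  coherent : ∀ α ∈ accPoints (Iio κ.ord), ∀ β ∈ accPoints (Iio κ.ord),
    α ∈ accPoints (C β) → C β ∩ Iio α = C α
  no_thread : ¬ ∃ D : Set Ordinal.{u}, IsClubIn D κ.ord ∧ ∀ α ∈ accPoints D, D ∩ Iio α = C α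

/-- The principle `□(κ)`: there is a `□(κ)`-sequence. -/
def SquarePrinciple (κ : Cardinal.{u}) : Prop :=
  ∃ C : Ordinal.{u} → Set Ordinal.{u}, IsSquareSeq κ C

/-! ### Chain conditions and layered partial orders -/

section Posets

variable {P : Type u} [PartialOrder P]

/-- `p` and `q` are compatible in the suborder `Q`: they have a common lower bound in `Q`. -/
def CompatIn (Q : Set P) (p q : P) : Prop := ∃ r ∈ Q, r ≤ p ∧ r ≤ q

/-- `A` is a maximal antichain of the suborder `Q`: its elements are pairwise incompatible in `Q`,
and no element of `Q` is incompatible in `Q` with all elements of `A`. -/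
def IsMaxAntichainIn (Q A : Set P) : Prop :=
  A ⊆ Q ∧ IsAntichain (CompatIn Q) A ∧ ∀ q ∈ Q, ∃ a ∈ A, CompatIn Q a q

/-- `Q` is a regular (complete) suborder of `P`: the inclusion preserves incompatibility and
maximal antichains. -/
def IsRegularSuborder (Q : Set P) : Prop :=
  (∀ p ∈ Q, ∀ q ∈ Q, ¬ CompatIn Q p q → ¬ CompatIn univ p q) ∧
    ∀ A : Set P, IsMaxAntichainIn Q A → IsMaxAntichainIn univ A

end Posets

/-- `P` is `κ`-Knaster: every set of `κ`-many conditions contains a subset of cardinality `κ` that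
consists of pairwise compatible conditions. -/
def IsKnaster (κ : Cardinal.{u}) (P : Type u) [PartialOrder P] : Prop :=
  ∀ A : Set P, #A = κ → ∃ B ⊆ A, #B = κ ∧ ∀ p ∈ B, ∀ q ∈ B, CompatIn univ p q

/-- `𝒫_κ(A)`: the collection of all subsets of `A` of cardinality less than `κ`. -/
def smallSubsets (κ : Cardinal.{u}) (A : Type u) : Set (Set A) := {x | #x < κ}

/-- `𝒞` is a club in `𝒫_κ(A)` in the sense of Jech: a subset of `𝒫_κ(A)` that is cofinal with
respect to inclusion and closed under unions of nonempty chains of cardinality less than `κ`. -/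
structure IsJechClub (κ : Cardinal.{u}) {A : Type u} (𝒞 : Set (Set A)) : Prop where
  subset : 𝒞 ⊆ smallSubsets κ A
  cofinal : ∀ x ∈ smallSubsets κ A, ∃ y ∈ 𝒞, x ⊆ y
  continuous : ∀ 𝒳 ⊆ 𝒞, 𝒳.Nonempty → IsChain (· ⊆ ·) 𝒳 → #𝒳 < κ → ⋃₀ 𝒳 ∈ 𝒞

/-- `𝒮` is stationary in `𝒫_κ(A)` in the sense of Jech. -/
def IsJechStationary (κ : Cardinal.{u}) {A : Type u} (𝒮 : Set (Set A)) : Prop :=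
  𝒮 ⊆ smallSubsets κ A ∧ ∀ 𝒞 : Set (Set A), IsJechClub κ 𝒞 → (𝒮 ∩ 𝒞).Nonempty

/-- `P` is `κ`-stationarily layered: the collection of all regular suborders of `P` of cardinality
less than `κ` is stationary in `𝒫_κ(P)`. -/
def IsStationarilyLayered (κ : Cardinal.{u}) (P : Type u) [PartialOrder P] : Prop :=
  IsJechStationary κ {Q : Set P | Q ∈ smallSubsets κ P ∧ IsRegularSuborder Q}

/-! ### Clubs and stationary sets in regular uncountable well-orders -/

section Stationary

/-! Contrapositive: a `□(κ)`-sequence yields a `κ`-Knaster order that is not `κ`-stationarily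
layered.

For some `δ`, both the limits `α > δ` with `δ ∈ C α` and those with `δ ∉ C α` are stationary
(`exists_isStationary_splitSet`); otherwise the values decided on clubs would assemble into a
thread. By coherence, a point of one side is never a limit point of `C η` for a larger `η` on the
other side.

Conditions of `AvoidanceOrder` promise finitely many points outside finitely many `C η`, with all
`η` on one side. The Knaster property (`AvoidanceOrder.isKnaster`) comes from pressing down on the
opposite side, where each such `C η` is bounded below the point considered. Layering fails because
every limit `α > δ` lies on some side, and the promise to avoid `C α` has no reduction to the
conditions supported below `α` (`not_isRegularSuborder_below`); these suborders form a club in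
`𝒫_κ`. -/

theorem mk_finset_lt {α : Type u} {κ : Cardinal.{u}} (hκ : ℵ₀ < κ) (hs : #α < κ) :
    #(Finset α) < κ := by
  cases finite_or_infinite α
  · exact (Cardinal.lt_aleph0_of_finite _).trans hκ
  · rwa [Cardinal.mk_finset_of_infinite]

variable {K : Type u} [LinearOrder K]

/-- `β` is a limit point of `D`: it is not minimal and `D` is unbounded below `β`. -/
def IsLimitPointOf (D : Set K) (β : K) : Prop :=
  (∃ γ, γ < β) ∧ ∀ γ < β, ∃ ξ ∈ D, γ < ξ ∧ ξ < β

theorem Finset.exists_forall_lt [NoMaxOrder K] [Nonempty K] (s : Finset K) :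
    ∃ b, ∀ a ∈ s, a < b := by
  obtain ⟨c, hc⟩ := s.exists_le
  obtain ⟨b, hb⟩ := exists_gt c
  exact ⟨b, fun a ha => (hc a ha).trans_lt hb⟩

theorem isLUB_inter_Ioi {t : Set K} {x b : K} (hx : IsLUB t x) (hb : b < x) :
    IsLUB (t ∩ Ioi b) x := by
  refine ⟨fun y hy => hx.1 hy.1, fun z hz => ?_⟩
  obtain ⟨y, hy, hby⟩ := (lt_isLUB_iff hx).1 hb
  refine hx.2 fun w hw => ?_
  rcases le_or_gt w y with h | h
  · exact h.trans (hz ⟨hy, hby⟩)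
  · exact hz ⟨hw, hby.trans h⟩

/-- Finitely many properties that hold on a final segment below `β` hold simultaneously. -/
theorem Finset.exists_lt_forall {ι : Type*} (s : Finset ι) {β : K} (hβ : ∃ γ, γ < β)
    {p : ι → K → Prop} (hp : ∀ i ∈ s, ∀ γ δ, γ ≤ δ → p i γ → p i δ)
    (h : ∀ i ∈ s, ∃ γ < β, p i γ) : ∃ γ < β, ∀ i ∈ s, p i γ := by
  induction s using Finset.cons_induction with
  | empty => simpa using hβ
  | cons i s hi ih =>
    simp only [Finset.mem_cons, forall_eq_or_imp] at hp h ⊢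
    obtain ⟨γ, hγ, hγs⟩ := ih hp.2 h.2
    obtain ⟨δ, hδ, hδi⟩ := h.1
    exact ⟨max γ δ, max_lt hγ hδ, hp.1 _ _ (le_max_right _ _) hδi,
      fun j hj => hp.2 j hj _ _ (le_max_left _ _) (hγs j hj)⟩

/-- The diagonal intersection of a family of subsets. -/
def diagonalInter (E : K → Set K) : Set K := {α | ∀ β < α, α ∈ E β}

theorem IsUpperSet.isClub {s : Set K} (hs : IsUpperSet s) (hne : s.Nonempty) : IsClub s := by
  obtain ⟨a, ha⟩ := hne
  exact ⟨hs.dirSupClosed, fun b => ⟨max a b, hs (le_max_left _ _) ha, le_max_right _ _⟩⟩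

theorem IsStationary.isCofinal {s : Set K} (hs : IsStationary s) : IsCofinal s := by
  intro a
  obtain ⟨b, hb, hab⟩ := hs ((isUpperSet_Ici a).isClub ⟨a, le_rfl⟩)
  exact ⟨b, hb, hab⟩

theorem bddAbove_of_mk_lt_cof {s : Set K} (h : #s < Order.cof K) : BddAbove s :=
  .of_not_isCofinal fun hs => (Order.cof_le hs).not_gt h

variable [WellFoundedLT K]

theorem exists_isLUB_of_mk_lt_cof {s : Set K} (h : #s < Order.cof K) : ∃ x, IsLUB s x := by
  obtain ⟨x, hx, hmin⟩ := (wellFounded_lt (α := K)).has_min (upperBounds s)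
    (bddAbove_of_mk_lt_cof h)
  exact ⟨x, hx, fun y hy => not_lt.1 (hmin y hy)⟩

theorem IsClub.diagonalInter [NoMaxOrder K] (hK : ℵ₀ < Order.cof K)
    (hI : ∀ a : K, #(Iio a) < Order.cof K) {E : K → Set K} (hE : ∀ β, IsClub (E β)) :
    IsClub (diagonalInter E) := by
  refine ⟨fun t ht _ _ x hx β hβ => ?_, fun a => ?_⟩
  · obtain ⟨y, hy, hβy⟩ := (lt_isLUB_iff hx).1 hβ
    exact (hE β).isLUB_mem (t := t ∩ Ioi β) (fun z hz => ht hz.1 β hz.2) ⟨y, hy, hβy⟩ (isLUB_inter_Ioi hx hβ)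
  · have key : ∀ b : K, ∃ c, b < c ∧ ∀ β < b, c ∈ E β := by
      intro b
      have hc : IsClub (⋂ β : Iio b, E β) :=
        IsClub.iInter hK.ne' (by simpa using hI b) fun β => hE β
      obtain ⟨b', hb'⟩ := exists_gt b
      obtain ⟨c, hc, hbc⟩ := hc.isCofinal b'
      exact ⟨c, hb'.trans_le hbc, fun β hβ => mem_iInter.1 hc ⟨β, hβ⟩⟩
    choose f hf hfE using key
    let g : ℕ → K := fun n => f^[n] a
    have hg : ∀ n, g (n + 1) = f (g n) := fun n => Function.iterate_succ_apply' f n a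
    have hmono : StrictMono g := strictMono_nat_of_lt_succ fun n => hg n ▸ hf _
    obtain ⟨x, hx⟩ := exists_isLUB_of_mk_lt_cof (s := range g)
      ((Cardinal.mk_le_aleph0_iff.2 (countable_range g).to_subtype).trans_lt hK)
    refine ⟨x, fun β hβ => ?_, hx.1 (mem_range_self 0)⟩
    obtain ⟨_, ⟨n, rfl⟩, hn⟩ := (lt_isLUB_iff hx).1 hβ
    have hnx : g n < x := (hmono n.lt_succ_self).trans_le (hx.1 (mem_range_self (n + 1)))
    refine (hE β).isLUB_mem (t := range g ∩ Ioi (g n)) ?_ ⟨g (n + 1), mem_range_self (n + 1), hmono n.lt_succ_self⟩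
      (isLUB_inter_Ioi hx hnx)
    rintro _ ⟨⟨m, rfl⟩, hm⟩
    have hnm : n < m := hmono.lt_iff_lt.1 hm
    obtain ⟨k, rfl⟩ := Nat.exists_eq_succ_of_ne_zero (Nat.ne_zero_of_lt hnm)
    rw [Nat.succ_eq_add_one, hg]
    exact hfE _ _ (hn.trans_le (hmono.monotone (Nat.lt_succ_iff.1 hnm)))

/-- Fodor's pressing-down lemma. -/
theorem IsStationary.exists_fiber [NoMaxOrder K] (hK : ℵ₀ < Order.cof K)
    (hI : ∀ a : K, #(Iio a) < Order.cof K) {S : Set K} (hS : IsStationary S) {f : K → K}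
    (hf : ∀ α ∈ S, f α < α) : ∃ γ, IsStationary {α ∈ S | f α = γ} := by
  by_contra! h
  simp only [not_isStationary_iff] at h
  choose E hE hd using h
  obtain ⟨α, hα, hαE⟩ := hS (IsClub.diagonalInter hK hI hE)
  exact (hd (f α)).le_bot ⟨⟨hα, rfl⟩, hαE _ (hf α hα)⟩

theorem IsStationary.inter_isClub (hK : ℵ₀ < Order.cof K) {S E : Set K} (hS : IsStationary S)
    (hE : IsClub E) : IsStationary (S ∩ E) := fun t ht => by
  simpa [inter_assoc] using hS (hE.inter hK.ne' ht)

theorem isClub_isLimitPointOf_univ [NoMaxOrder K] [Nonempty K] (hK : ℵ₀ < Order.cof K)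
    (hI : ∀ a : K, #(Iio a) < Order.cof K) :
    IsClub {α : K | IsLimitPointOf univ α} := by
  have h1 : IsClub {α : K | ∃ γ, γ < α} := by
    refine IsUpperSet.isClub (fun a b hab ⟨c, hc⟩ => ⟨c, hc.trans_le hab⟩) ?_
    obtain ⟨b, hb⟩ := exists_gt (Classical.arbitrary K)
    exact ⟨b, _, hb⟩
  have h2 : IsClub (diagonalInter fun γ : K => {α | ∃ ξ, γ < ξ ∧ ξ < α}) := by
    refine IsClub.diagonalInter hK hI fun γ => IsUpperSet.isClub ?_ ?_
    · exact fun a b hab ⟨c, hc, hca⟩ => ⟨c, hc, hca.trans_le hab⟩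
    · obtain ⟨b, hb⟩ := exists_gt γ
      obtain ⟨c, hc⟩ := exists_gt b
      exact ⟨c, b, hb, hc⟩
  convert h1.inter hK.ne' h2 using 1
  ext α
  simp [IsLimitPointOf, diagonalInter]

end Stationary

/-! ### Coherent sequences without threads on a regular well-order -/

section Coherent

variable {K : Type u} [LinearOrder K]

/-- A coherent sequence of clubs without a thread, indexed by a well-order. -/
structure IsThreadlessCoherent (C : K → Set K) : Prop where
  subset : ∀ α, IsLimitPointOf univ α → C α ⊆ Iio α
  unbounded : ∀ α, IsLimitPointOf univ α → IsLimitPointOf (C α) α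
  coherent : ∀ α, IsLimitPointOf univ α → ∀ β < α, IsLimitPointOf (C α) β →
    β ∈ C α ∧ C α ∩ Iio β = C β
  no_thread : ¬ ∃ D : Set K, IsCofinal D ∧
    ∀ β, IsLimitPointOf D β → β ∈ D ∧ D ∩ Iio β = C β

/-- The limit points above `δ`, split according to whether `δ` belongs to `C α`. -/
def splitSet (C : K → Set K) (δ : K) (e : Bool) : Set K :=
  {α | IsLimitPointOf univ α ∧ δ < α ∧ (δ ∈ C α ↔ e = true)}

variable {C : K → Set K}

/-- Coherence would give `C β = C η ∩ Iio β`, but the two clubs disagree about `δ`. -/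
theorem not_isLimitPointOf_of_mem_splitSet (hC : IsThreadlessCoherent C) {δ : K} {e : Bool}
    {β η : K} (hβ : β ∈ splitSet C δ (!e)) (hη : η ∈ splitSet C δ e) (h : β < η) :
    ¬ IsLimitPointOf (C η) β := by
  intro hl
  have h1 := (hC.coherent η hη.1 β h hl).2
  have h2 : δ ∈ C η ↔ δ ∈ C β := by
    rw [← h1]
    exact ⟨fun hd => ⟨hd, hβ.2.1⟩, fun hd => hd.1⟩
  have h3 := hβ.2.2
  have h4 := hη.2.2
  cases e <;> simp_all

theorem exists_isStationary_splitSet [WellFoundedLT K] [NoMaxOrder K] [Nonempty K]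
    (hK : ℵ₀ < Order.cof K) (hI : ∀ a : K, #(Iio a) < Order.cof K)
    (hC : IsThreadlessCoherent C) : ∃ δ, ∀ e, IsStationary (splitSet C δ e) := by
  by_contra! h
  simp only [not_isStationary_iff] at h
  choose e E hE hd using h
  have hF := (isClub_isLimitPointOf_univ hK hI).inter hK.ne' (IsClub.diagonalInter hK hI hE)
  -- `e δ` names a nonstationary side, so on a club `δ ∈ C α` holds exactly when `e δ = false`.
  -- Diagonalising over `δ` makes `D` agree with `C α` for club many limits `α`, and coherence
  -- carries this down to all limit points of `D`.
  set D : Set K := {δ | e δ = false}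
  have hD : ∀ α, IsLimitPointOf univ α → α ∈ diagonalInter E → D ∩ Iio α = C α := by
    intro α hα hαE
    have key : ∀ δ < α, ¬ (δ ∈ C α ↔ e δ = true) := fun δ hδ hiff =>
      (hd δ).le_bot ⟨⟨hα, hδ, hiff⟩, hαE δ hδ⟩
    ext δ
    constructor
    · rintro ⟨h1, h2⟩
      have h1 : e δ = false := h1
      simpa [h1] using key δ h2
    · intro hδ
      have hlt := hC.subset α hα hδ
      refine ⟨?_, hlt⟩
      change e δ = false
      simpa [hδ] using key δ hlt
  refine hC.no_thread ⟨D, fun a => ?_, fun β hβ => ?_⟩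
  · obtain ⟨b, hb⟩ := exists_gt a
    obtain ⟨α, ⟨hα, hαE⟩, hbα⟩ := hF.isCofinal b
    obtain ⟨ξ, hξ, haξ, -⟩ := (hC.unbounded α hα).2 a (hb.trans_le hbα)
    exact ⟨ξ, ((hD α hα hαE).symm ▸ hξ : ξ ∈ D ∩ Iio α).1, haξ.le⟩
  · obtain ⟨b, hb⟩ := exists_gt β
    obtain ⟨α, ⟨hα, hαE⟩, hbα⟩ := hF.isCofinal b
    have hβα := hb.trans_le hbα
    have hDα := hD α hα hαE
    have hl : IsLimitPointOf (C α) β := by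
      refine ⟨hβ.1, fun γ hγ => ?_⟩
      obtain ⟨ξ, hξ, h1, h2⟩ := hβ.2 γ hγ
      exact ⟨ξ, hDα ▸ ⟨hξ, h2.trans hβα⟩, h1, h2⟩
    obtain ⟨h1, h2⟩ := hC.coherent α hα β hβα hl
    refine ⟨(hDα.symm ▸ h1 : β ∈ D ∩ Iio α).1, ?_⟩
    rw [← h2, ← hDα, inter_assoc, inter_eq_self_of_subset_right (Iio_subset_Iio hβα.le)]

end Coherent

/-! ### Regular suborders and reductions -/

section Reduction

variable {P : Type u} [PartialOrder P]

/-- Every condition has a reduction to a regular suborder. -/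
theorem IsRegularSuborder.exists_reduction {Q : Set P} (hQ : IsRegularSuborder Q) (p : P) :
    ∃ q ∈ Q, ∀ r ∈ Q, r ≤ q → CompatIn univ r p := by
  by_contra! h
  obtain ⟨A, hA⟩ := zorn_subset
    {A : Set P | A ⊆ {r ∈ Q | ¬ CompatIn univ r p} ∧ IsAntichain (CompatIn Q) A} (by
      intro c hc hchain
      refine ⟨⋃₀ c, ⟨sUnion_subset fun s hs => (hc hs).1, ?_⟩, fun s hs => subset_sUnion_of_mem hs⟩
      rintro a ⟨s, hs, has⟩ b ⟨t, ht, hbt⟩ hab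
      rcases hchain.total hs ht with hst | hst
      · exact (hc ht).2 (hst has) hbt hab
      · exact (hc hs).2 has (hst hbt) hab)
  -- Without a reduction, every `q ∈ Q` has an extension in `Q` incompatible with `p`, so an
  -- antichain maximal among such elements is maximal in `Q`. Regularity then makes it meet `p`.
  have hAQ : IsMaxAntichainIn Q A := by
    refine ⟨fun a ha => (hA.prop.1 ha).1, hA.prop.2, fun q hq => ?_⟩
    obtain ⟨r, hr, hrq, hrp⟩ := h q hq
    by_contra! hno
    have hra : ∀ a ∈ A, ¬ CompatIn Q a r := fun a ha ⟨s, hs, hsa, hsr⟩ =>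
      hno a ha ⟨s, hs, hsa, hsr.trans hrq⟩
    have hins : insert r A ⊆ A := hA.le_of_ge ⟨insert_subset ⟨hr, hrp⟩ hA.prop.1,
      hA.prop.2.insert (fun b hb _ hc => hra b hb hc)
        fun b hb _ ⟨s, hs, hsr, hsb⟩ => hra b hb ⟨s, hs, hsb, hsr⟩⟩ (subset_insert r A)
    exact hra r (hins (mem_insert r A)) ⟨r, hr, le_rfl, le_rfl⟩
  obtain ⟨a, ha, hap⟩ := (hQ.2 A hAQ).2.2 p (mem_univ p)
  exact (hA.prop.1 ha).2 hap

end Reduction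

/-! ### The avoidance order -/

/-- Conditions are triples consisting of a label `e`, a finite set of points and a finite set of
indices from `S e` such that no chosen point lies in `C η` for a chosen index `η`. -/
@[ext]
structure AvoidanceOrder {K : Type u} (C : K → Set K) (S : Bool → Set K) where
  label : Bool
  points : Finset K
  indices : Finset K
  indices_subset : ∀ η ∈ indices, η ∈ S label
  avoid : ∀ η ∈ indices, ∀ ξ ∈ points, ξ ∉ C η

namespace AvoidanceOrder

variable {K : Type u} {C : K → Set K} {S : Bool → Set K}

instance : PartialOrder (AvoidanceOrder C S) where
  le p q := p.label = q.label ∧ q.points ⊆ p.points ∧ q.indices ⊆ p.indices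
  le_refl p := ⟨rfl, Finset.Subset.refl _, Finset.Subset.refl _⟩
  le_trans p q r h1 h2 := ⟨h1.1.trans h2.1, h2.2.1.trans h1.2.1, h2.2.2.trans h1.2.2⟩
  le_antisymm p q h1 h2 := AvoidanceOrder.ext h1.1 (h2.2.1.antisymm h1.2.1)
    (h2.2.2.antisymm h1.2.2)

theorem not_compatIn {p q : AvoidanceOrder C S} {Q : Set (AvoidanceOrder C S)} {η ξ : K}
    (hη : η ∈ p.indices) (hξ : ξ ∈ q.points) (h : ξ ∈ C η) : ¬ CompatIn Q q p :=
  fun ⟨r, _, hrq, hrp⟩ => r.avoid η (hrp.2.2 hη) ξ (hrq.2.1 hξ) h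

variable [LinearOrder K]

/-- The finite set of all points and indices occurring in a condition. -/
def support (p : AvoidanceOrder C S) : Finset K := p.points ∪ p.indices

theorem compatIn_univ {p q : AvoidanceOrder C S} (hl : p.label = q.label)
    (h1 : ∀ η ∈ p.indices, ∀ ξ ∈ q.points, ξ ∉ C η)
    (h2 : ∀ η ∈ q.indices, ∀ ξ ∈ p.points, ξ ∉ C η) : CompatIn univ p q := by
  refine ⟨⟨p.label, p.points ∪ q.points, p.indices ∪ q.indices, fun η hη => ?_,
    fun η hη ξ hξ => ?_⟩, mem_univ _, ⟨rfl, Finset.subset_union_left, Finset.subset_union_left⟩,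
      ⟨hl, Finset.subset_union_right, Finset.subset_union_right⟩⟩
  · rcases Finset.mem_union.1 hη with h | h
    · exact p.indices_subset η h
    · exact hl ▸ q.indices_subset η h
  · rcases Finset.mem_union.1 hη with h | h <;> rcases Finset.mem_union.1 hξ with h' | h'
    · exact p.avoid η h ξ h'
    · exact h1 η h ξ h'
    · exact h2 η h ξ h'
    · exact q.avoid η h ξ h'

/-- The suborder of all conditions with support below `α`. -/
def below (C : K → Set K) (S : Bool → Set K) (α : K) : Set (AvoidanceOrder C S) :=
  {p | ∀ ξ ∈ p.support, ξ < α}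

theorem below_mono {α β : K} (h : α ≤ β) : below C S α ⊆ below C S β :=
  fun _ hp ξ hξ => (hp ξ hξ).trans_le h

/-- The condition with sole index `α` and no points has no reduction. Given a candidate `q`, some `ξ
∈ C α` lies above the support of `q`; adding it to the points of `q` is harmless because each `C η`
stays below `η`, yet contradicts the index `α`. -/
theorem not_isRegularSuborder_below (hsub : ∀ e, ∀ η ∈ S e, C η ⊆ Iio η) {e : Bool} {α : K}
    (hα : α ∈ S e) (hl : IsLimitPointOf (C α) α) : ¬ IsRegularSuborder (below C S α) := by
  intro hreg
  obtain ⟨q, hq, hred⟩ := hreg.exists_reduction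
    (⟨e, ∅, {α}, by simpa using hα, by simp⟩ : AvoidanceOrder C S)
  have hbd : ∃ γ < α, ∀ ξ ∈ q.support, ξ ≤ γ := by
    obtain ⟨γ₀, hγ₀⟩ := hl.1
    rcases q.support.eq_empty_or_nonempty with h | h
    · exact ⟨γ₀, hγ₀, by simp [h]⟩
    · exact ⟨_, hq _ (q.support.max'_mem h), fun ξ hξ => q.support.le_max' ξ hξ⟩
  obtain ⟨γ, hγ, hbd⟩ := hbd
  obtain ⟨ξ, hξ, hγξ, hξα⟩ := hl.2 γ hγ
  let r : AvoidanceOrder C S := ⟨q.label, insert ξ q.points, q.indices, q.indices_subset, by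
    intro η hη ζ hζ
    rcases Finset.mem_insert.1 hζ with rfl | hζ
    · intro hζ
      have h1 : ζ < η := hsub _ η (q.indices_subset η hη) hζ
      exact (h1.trans_le (hbd η (Finset.mem_union_right _ hη))).not_gt hγξ
    · exact q.avoid η hη ζ hζ⟩
  refine not_compatIn (p := ⟨e, ∅, {α}, by simpa using hα, by simp⟩) (q := r) (η := α) (ξ := ξ)
    (by simp) (by simp [r]) hξ (hred r ?_ ⟨rfl, by simp [r], by simp [r]⟩)
  intro ζ hζ
  simp only [support, r, Finset.insert_union, Finset.mem_insert] at hζ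
  rcases hζ with rfl | hζ
  · exact hξα
  · exact hq ζ hζ

theorem mk_below_lt {κ : Cardinal.{u}} (hκ : ℵ₀ < κ) {α : K} (hα : #(Iio α) < κ) :
    #(below C S α) < κ := by
  classical
  let f : below C S α → Bool × Finset (Iio α) × Finset (Iio α) := fun p =>
    (p.1.label, p.1.points.subtype (· ∈ Iio α), p.1.indices.subtype (· ∈ Iio α))
  have hf : Function.Injective f := by
    rintro ⟨p, hp⟩ ⟨q, hq⟩ h
    simp only [f, Prod.mk.injEq] at h
    obtain ⟨h1, h2, h3⟩ := h
    have h2 := congrArg (Finset.map (Function.Embedding.subtype _)) h2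
    have h3 := congrArg (Finset.map (Function.Embedding.subtype _)) h3
    rw [Finset.subtype_map_of_mem (p := (· ∈ Iio α)) fun ξ hξ => hp ξ (Finset.mem_union_left _ hξ),
      Finset.subtype_map_of_mem (p := (· ∈ Iio α)) fun ξ hξ => hq ξ (Finset.mem_union_left _ hξ)] at h2
    rw [Finset.subtype_map_of_mem (p := (· ∈ Iio α)) fun ξ hξ => hp ξ (Finset.mem_union_right _ hξ),
      Finset.subtype_map_of_mem (p := (· ∈ Iio α)) fun ξ hξ => hq ξ (Finset.mem_union_right _ hξ)] at h3
    exact Subtype.ext (AvoidanceOrder.ext h1 h2 h3)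
  refine (Cardinal.mk_le_of_injective hf).trans_lt ?_
  have hF := mk_finset_lt hκ hα
  simp only [Cardinal.mk_prod, Cardinal.lift_id, Cardinal.mk_bool, Cardinal.lift_uzero]
  exact Cardinal.mul_lt_of_lt hκ.le (by simpa using (Cardinal.natCast_lt_aleph0 (n := 2)).trans hκ)
    (Cardinal.mul_lt_of_lt hκ.le hF hF)

/-- Supports are finite, so a support below a supremum is already below one of the terms; hence
`below` is continuous in `α`. -/
theorem isJechClub_below [WellFoundedLT K] [NoMaxOrder K] [Nonempty K] {κ : Cardinal.{u}} (hκ : ℵ₀ < κ)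
    (hcof : Order.cof K = κ) (hI : ∀ a : K, #(Iio a) < κ) {F : Set K} (hF : IsClub F) :
    IsJechClub κ {Q | ∃ α ∈ F, below C S α = Q} where
  subset := by
    rintro _ ⟨α, -, rfl⟩
    exact mk_below_lt hκ (hI α)
  cofinal x hx := by
    have hb : ∀ p : AvoidanceOrder C S, ∃ b, ∀ ξ ∈ p.support, ξ < b :=
      fun p => p.support.exists_forall_lt
    choose b hb using hb
    obtain ⟨a, ha⟩ := bddAbove_of_mk_lt_cof (s := b '' x)
      (Cardinal.mk_image_le.trans_lt (hcof ▸ hx))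
    obtain ⟨α, hα, haα⟩ := hF.isCofinal a
    exact ⟨_, ⟨α, hα, rfl⟩, fun p hp ξ hξ =>
      (hb p ξ hξ).trans_le ((ha (mem_image_of_mem b hp)).trans haα)⟩
  continuous 𝒳 h𝒳 hne _ hcard := by
    choose a haF ha using fun X : 𝒳 => h𝒳 X.2
    obtain ⟨s, hs⟩ := exists_isLUB_of_mk_lt_cof (s := range a)
      (Cardinal.mk_range_le.trans_lt (hcof ▸ hcard))
    have : Nonempty 𝒳 := hne.to_subtype
    refine ⟨s, hF.isLUB_mem (range_subset_iff.2 haF) (range_nonempty a) hs, ?_⟩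
    refine Subset.antisymm (fun p hp => ?_) (sUnion_subset fun X hX => ?_)
    · have : ∃ X : 𝒳, ∀ ξ ∈ p.support, ξ < a X := by
        rcases p.support.eq_empty_or_nonempty with h | h
        · exact ⟨Classical.arbitrary _, by simp [h]⟩
        · obtain ⟨_, ⟨X, rfl⟩, hX⟩ := (lt_isLUB_iff hs).1 (hp _ (p.support.max'_mem h))
          exact ⟨X, fun ξ hξ => (p.support.le_max' ξ hξ).trans_lt hX⟩
      obtain ⟨X, hX⟩ := this
      exact ⟨X, X.2, ha X ▸ hX⟩
    · have hXa : below C S (a ⟨X, hX⟩) = X := ha ⟨X, hX⟩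
      rw [← hXa]
      exact below_mono (hs.1 (mem_range_self _))

end AvoidanceOrder

/-! ### The Knaster property of the avoidance order -/

namespace AvoidanceOrder

variable {K : Type u} {C : K → Set K} {S : Bool → Set K}

theorem exists_label_mk_eq {κ : Cardinal.{u}} (hκ : ℵ₀ ≤ κ) {A : Set (AvoidanceOrder C S)}
    (hA : #A = κ) : ∃ e, #{p ∈ A | p.label = e} = κ := by
  by_contra! h
  have hlt : ∀ e, #{p ∈ A | p.label = e} < κ := fun e =>
    ((Cardinal.mk_le_mk_of_subset fun p hp => hp.1).trans_eq hA).lt_of_ne (h e)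
  have hun : A = {p ∈ A | p.label = true} ∪ {p ∈ A | p.label = false} := by
    ext p
    cases h : p.label <;> simp [h]
  refine (Cardinal.add_lt_of_lt hκ (hlt true) (hlt false)).not_ge ?_
  rw [← hA]
  conv_lhs => rw [hun]
  exact Cardinal.mk_union_le _ _

variable [LinearOrder K]

/-- As `β` lies on the side opposite to the indices, it differs from each index `η` and is not a
limit point of `C η` when `β < η`. Finitely many bounds below `β` have a maximum below `β`. -/
theorem exists_bound (hlim : ∀ e, ∀ β ∈ S e, ∃ γ, γ < β) (hdisj : ∀ e, Disjoint (S e) (S (!e)))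
    (hsep : ∀ e, ∀ β ∈ S (!e), ∀ η ∈ S e, β < η → ¬ IsLimitPointOf (C η) β)
    (p : AvoidanceOrder C S) {β : K} (hβ : β ∈ S (!p.label)) :
    ∃ γ < β, (∀ ξ ∈ p.support, ξ < β → ξ ≤ γ) ∧
      ∀ η ∈ p.indices, β ≤ η → ∀ ξ ∈ C η, ξ < β → ξ ≤ γ := by
  have hmin := hlim _ β hβ
  obtain ⟨γ, hγ, h1⟩ := p.support.exists_lt_forall hmin (p := fun ξ γ => ξ < β → ξ ≤ γ)
    (fun ξ _ γ δ h h' hξ => (h' hξ).trans h) (fun ξ _ => by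
      rcases lt_or_ge ξ β with h | h
      · exact ⟨ξ, h, fun _ => le_rfl⟩
      · obtain ⟨γ, hγ⟩ := hmin
        exact ⟨γ, hγ, fun h' => absurd h' h.not_gt⟩)
  obtain ⟨δ, hδ, h2⟩ := p.indices.exists_lt_forall hmin
    (p := fun η γ => β ≤ η → ∀ ξ ∈ C η, ξ < β → ξ ≤ γ)
    (fun η _ γ δ h h' hη ξ hξ hξβ => (h' hη ξ hξ hξβ).trans h) (fun η hη => by
      rcases lt_or_ge η β with h | h
      · obtain ⟨γ, hγ⟩ := hmin
        exact ⟨γ, hγ, fun h' => absurd h h'.not_gt⟩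
      · have hηS := p.indices_subset η hη
        have hne : β ≠ η := by
          rintro rfl
          exact (hdisj p.label).le_bot ⟨hηS, hβ⟩
        have := hsep _ β hβ η hηS (h.lt_of_ne hne)
        simp only [IsLimitPointOf, not_and, not_forall] at this
        obtain ⟨γ, hγ, hn⟩ := this hmin
        push Not at hn
        exact ⟨γ, hγ, fun _ ξ hξ hξβ => not_lt.1 fun hlt => (hn ξ hξ hlt).not_gt hξβ⟩)
  exact ⟨max γ δ, max_lt hγ hδ, fun ξ hξ h => (h1 ξ hξ h).trans (le_max_left _ _),
    fun η hη h ξ hξ h' => (h2 η hη h ξ hξ h').trans (le_max_right _ _)⟩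

/-- A criterion for the compatibility of `p` and `q`: their points agree, up to `β` for `q` and up
to `γ` for `p`, and apart from that `q` and its clubs leave the interval between `δ` and `β` free. -/
theorem compatIn_univ_of_lt (hsub : ∀ e, ∀ η ∈ S e, C η ⊆ Iio η) {p q : AvoidanceOrder C S}
    {δ γ β : K} (hl : p.label = q.label) (hδγ : δ < γ)
    (hp : ∀ ξ ∈ p.support, ξ < β) (hroot : ∀ ξ, ξ < β → ξ ∈ q.points → ξ ∈ p.points)
    (hroot' : ∀ ξ, ξ < γ → ξ ∈ p.points → ξ ∈ q.points)
    (hq : ∀ ξ ∈ q.support, ξ < β → ξ ≤ δ)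
    (hqC : ∀ η ∈ q.indices, β ≤ η → ∀ ξ ∈ C η, ξ < β → ξ ≤ δ) : CompatIn univ p q := by
  refine compatIn_univ hl (fun η hη ξ hξ hξη => ?_) (fun η hη ξ hξ hξη => ?_)
  · have h1 : ξ < η := hsub _ η (p.indices_subset η hη) hξη
    have h2 : η < β := hp η (Finset.mem_union_right _ hη)
    exact p.avoid η hη ξ (hroot ξ (h1.trans h2) hξ) hξη
  · rcases lt_or_ge ξ γ with h | h
    · exact q.avoid η hη ξ (hroot' ξ h hξ) hξη
    · have hξβ := hp ξ (Finset.mem_union_left _ hξ)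
      rcases lt_or_ge η β with hηβ | hηβ
      · have h1 : ξ < η := hsub _ η (q.indices_subset η hη) hξη
        exact (hδγ.trans_le (h.trans h1.le)).not_ge (hq η (Finset.mem_union_right _ hη) hηβ)
      · exact (hδγ.trans_le h).not_ge (hqC η hη hηβ ξ hξη hξβ)

theorem isKnaster [WellFoundedLT K] [NoMaxOrder K] [Nonempty K] {κ : Cardinal.{u}} (hκ : ℵ₀ < κ)
    (hcard : #K = κ) (hcof : Order.cof K = κ) (hI : ∀ a : K, #(Iio a) < κ)
    (hS : ∀ e, IsStationary (S e)) (hsub : ∀ e, ∀ η ∈ S e, C η ⊆ Iio η)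
    (hlim : ∀ e, ∀ β ∈ S e, ∃ γ, γ < β) (hdisj : ∀ e, Disjoint (S e) (S (!e)))
    (hsep : ∀ e, ∀ β ∈ S (!e), ∀ η ∈ S e, β < η → ¬ IsLimitPointOf (C η) β) :
    IsKnaster κ (AvoidanceOrder C S) := by
  classical
  intro A hA
  obtain ⟨e, he⟩ := exists_label_mk_eq hκ.le hA
  obtain ⟨p⟩ := Cardinal.eq.1 (hcard.trans he.symm)
  have hK : ℵ₀ < Order.cof K := hcof ▸ hκ
  have hIK : ∀ a : K, #(Iio a) < Order.cof K := fun a => hcof ▸ hI a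
  have hE : IsClub (diagonalInter fun γ => {β : K | ∀ ξ ∈ (p γ).1.support, ξ < β}) :=
    IsClub.diagonalInter hK hIK fun γ => IsUpperSet.isClub
      (fun a b hab ha ξ hξ => (ha ξ hξ).trans_le hab) (p γ).1.support.exists_forall_lt
  -- Pressing down takes place on the side opposite to the common label `e`, within the club of `β`
  -- that bound the supports of all earlier conditions.
  have hT := (hS (!e)).inter_isClub hK hE
  have hb : ∀ β ∈ S (!e), ∃ γ < β, (∀ ξ ∈ (p β).1.support, ξ < β → ξ ≤ γ) ∧
      ∀ η ∈ (p β).1.indices, β ≤ η → ∀ ξ ∈ C η, ξ < β → ξ ≤ γ := fun β hβ =>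
    exists_bound hlim hdisj hsep (p β).1 (by rw [(p β).2.2]; exact hβ)
  choose! f hf hf1 hf2 using hb
  obtain ⟨δ, hδ⟩ := hT.exists_fiber hK hIK fun α hα => hf α hα.1
  set T : Set K := {β ∈ S (!e) ∩ diagonalInter fun γ => {β : K | ∀ ξ ∈ (p γ).1.support, ξ < β} |
    f β = δ}
  have hIic : #(Finset (Iic δ)) < κ := by
    obtain ⟨δ', hδ'⟩ := exists_gt δ
    exact mk_finset_lt hκ ((Cardinal.mk_le_mk_of_subset fun x hx =>
      (lt_of_le_of_lt hx hδ' : x < δ')).trans_lt (hI δ'))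
  -- There are fewer than `κ` possible traces of the points on `Iic δ`, so one trace `r` occurs
  -- stationarily often and serves as a common root.
  have hcover : T = ⋃ r : Finset (Iic δ), {β ∈ T | (p β).1.points.subtype (· ∈ Iic δ) = r} := by
    ext β
    simp
  rw [hcover, isStationary_iUnion_iff hK.ne' (by simpa [hcof] using hIic)] at hδ
  obtain ⟨r, hr⟩ := hδ
  have hmem : ∀ β ∈ T, ∀ ξ, ξ < β → ξ ∈ (p β).1.points → ξ ≤ δ := fun β hβ ξ hξ hξp =>
    hβ.2 ▸ hf1 β hβ.1.1 ξ (Finset.mem_union_left _ hξp) hξ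
  have hroot : ∀ β β', (p β).1.points.subtype (· ∈ Iic δ) = r →
      (p β').1.points.subtype (· ∈ Iic δ) = r → ∀ ξ ≤ δ, ξ ∈ (p β).1.points →
      ξ ∈ (p β').1.points := by
    intro β β' h h' ξ hξ hp
    have : (⟨ξ, hξ⟩ : Iic δ) ∈ (p β).1.points.subtype (· ∈ Iic δ) := by simpa using hp
    rw [h, ← h'] at this
    simpa using this
  have hcompat : ∀ γ β, γ ∈ T → β ∈ T → (p γ).1.points.subtype (· ∈ Iic δ) = r →
      (p β).1.points.subtype (· ∈ Iic δ) = r → γ < β → CompatIn univ (p γ).1 (p β).1 := by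
    intro γ β hγ hβ hγr hβr hlt
    refine compatIn_univ_of_lt hsub ((p γ).2.2.trans (p β).2.2.symm)
      (hγ.2 ▸ hf γ hγ.1.1 : δ < γ) (hβ.1.2 γ hlt)
      (fun ξ hξ hp => hroot β γ hβr hγr ξ (hmem β hβ ξ hξ hp) hp)
      (fun ξ hξ hp => hroot γ β hγr hβr ξ (hmem γ hγ ξ hξ hp) hp) ?_ ?_
    · exact hβ.2 ▸ hf1 β hβ.1.1
    · exact hβ.2 ▸ hf2 β hβ.1.1
  refine ⟨(fun β => (p β).1) '' {β ∈ T | (p β).1.points.subtype (· ∈ Iic δ) = r}, ?_, ?_, ?_⟩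
  · rintro _ ⟨β, -, rfl⟩
    exact (p β).2.1
  · have hinj : Function.Injective fun β => (p β).1 := Subtype.val_injective.comp p.injective
    rw [Cardinal.mk_image_eq hinj]
    refine le_antisymm ((Cardinal.mk_set_le _).trans_eq hcard) ?_
    rw [← hcof]
    exact Order.cof_le hr.isCofinal
  · rintro _ ⟨γ, hγ, rfl⟩ _ ⟨β, hβ, rfl⟩
    rcases lt_trichotomy γ β with h | rfl | h
    · exact hcompat γ β hγ.1 hβ.1 hγ.2 hβ.2 h
    · exact ⟨_, mem_univ _, le_rfl, le_rfl⟩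
    · obtain ⟨s, hs, h1, h2⟩ := hcompat β γ hβ.1 hγ.1 hβ.2 hγ.2 h
      exact ⟨s, hs, h2, h1⟩

end AvoidanceOrder

/-- On a regular uncountable well-order with a threadless coherent sequence of clubs there is a
Knaster order that is not stationarily layered. -/
theorem IsThreadlessCoherent.exists_isKnaster_not_layered {K : Type u} [LinearOrder K]
    [WellFoundedLT K] [NoMaxOrder K] [Nonempty K] {κ : Cardinal.{u}} (hκ : ℵ₀ < κ)
    (hcard : #K = κ) (hcof : Order.cof K = κ) (hI : ∀ a : K, #(Iio a) < κ) {C : K → Set K}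
    (hC : IsThreadlessCoherent C) :
    ∃ (P : Type u) (_ : PartialOrder P), IsKnaster κ P ∧ ¬ IsStationarilyLayered κ P := by
  have hK : ℵ₀ < Order.cof K := hcof ▸ hκ
  have hIK : ∀ a : K, #(Iio a) < Order.cof K := fun a => hcof ▸ hI a
  obtain ⟨δ, hδ⟩ := exists_isStationary_splitSet hK hIK hC
  have hsub : ∀ e, ∀ η ∈ splitSet C δ e, C η ⊆ Iio η := fun e η hη => hC.subset η hη.1
  refine ⟨AvoidanceOrder C (splitSet C δ), inferInstance, AvoidanceOrder.isKnaster hκ hcard hcof hI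
    hδ hsub (fun e β hβ => hβ.1.1) (fun e => ?_)
    (fun e β hβ η hη h => not_isLimitPointOf_of_mem_splitSet hC hβ hη h), fun hlay => ?_⟩
  · refine disjoint_left.2 fun α h1 h2 => ?_
    have h3 := h1.2.2
    have h4 := h2.2.2
    cases e <;> simp_all
  · have hF : IsClub ({α : K | IsLimitPointOf univ α} ∩ Ioi δ) :=
      (isClub_isLimitPointOf_univ hK hIK).inter hK.ne'
        ((isUpperSet_Ioi δ).isClub (exists_gt δ))
    obtain ⟨_, ⟨-, hreg⟩, α, ⟨hα, hδα⟩, rfl⟩ :=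
      hlay.2 _ (AvoidanceOrder.isJechClub_below (S := splitSet C δ) (C := C) hκ hcof hI hF)
    classical
    -- The label is read off from `C α`, so that `α` is itself an admissible index.
    exact AvoidanceOrder.not_isRegularSuborder_below hsub (e := decide (δ ∈ C α))
      ⟨hα, hδα, by simp⟩ (hC.unbounded α hα) hreg

/-! ### Square sequences as coherent sequences on `κ.ord.ToType` -/

section Transfer

variable {κ : Cardinal.{u}}

/-- The value of an element of `κ.ord.ToType` as an ordinal. -/
noncomputable def ordVal (κ : Cardinal.{u}) (a : κ.ord.ToType) : Ordinal.{u} :=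
  (Ordinal.ToType.mk.symm a).1

theorem ordVal_lt_ord (a : κ.ord.ToType) : ordVal κ a < κ.ord := (Ordinal.ToType.mk.symm a).2

theorem ordVal_lt_ordVal {a b : κ.ord.ToType} : ordVal κ a < ordVal κ b ↔ a < b := by
  simp [ordVal]

theorem ordVal_injective : Function.Injective (ordVal κ) :=
  Subtype.val_injective.comp (OrderIso.injective _)

theorem exists_ordVal_eq {o : Ordinal.{u}} (ho : o < κ.ord) : ∃ a, ordVal κ a = o :=
  ⟨Ordinal.ToType.mk ⟨o, ho⟩, by simp [ordVal]⟩

theorem isLimitPointOf_preimage_ordVal {D : Set Ordinal.{u}} {a : κ.ord.ToType} :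
    IsLimitPointOf (ordVal κ ⁻¹' D) a ↔
      ordVal κ a ≠ 0 ∧ ∀ γ < ordVal κ a, ∃ ξ ∈ D, γ < ξ ∧ ξ < ordVal κ a := by
  constructor
  · rintro ⟨⟨c, hc⟩, h⟩
    refine ⟨(ordVal_lt_ordVal.2 hc).ne_bot, fun γ hγ => ?_⟩
    obtain ⟨b, rfl⟩ := exists_ordVal_eq (hγ.trans (ordVal_lt_ord a))
    obtain ⟨ξ, hξ, h1, h2⟩ := h b (ordVal_lt_ordVal.1 hγ)
    exact ⟨_, hξ, ordVal_lt_ordVal.2 h1, ordVal_lt_ordVal.2 h2⟩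
  · rintro ⟨h0, h⟩
    refine ⟨?_, fun γ hγ => ?_⟩
    · have hpos : 0 < ordVal κ a := pos_iff_ne_zero.2 h0
      obtain ⟨b, hb⟩ := exists_ordVal_eq (hpos.trans (ordVal_lt_ord a))
      exact ⟨b, ordVal_lt_ordVal.1 (hb ▸ hpos)⟩
    · obtain ⟨ξ, hξ, h1, h2⟩ := h _ (ordVal_lt_ordVal.2 hγ)
      obtain ⟨b, rfl⟩ := exists_ordVal_eq (h2.trans (ordVal_lt_ord a))
      exact ⟨b, hξ, ordVal_lt_ordVal.1 h1, ordVal_lt_ordVal.1 h2⟩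

theorem ordVal_mem_accPoints {a : κ.ord.ToType} :
    ordVal κ a ∈ accPoints (Iio κ.ord) ↔ IsLimitPointOf univ a := by
  have h : (univ : Set κ.ord.ToType) = ordVal κ ⁻¹' Iio κ.ord :=
    (eq_univ_of_forall fun a => ordVal_lt_ord a).symm
  rw [h, isLimitPointOf_preimage_ordVal]
  exact and_iff_right (ordVal_lt_ord a)

theorem IsClubIn.mem_of_unbounded {C : Set Ordinal.{u}} {α β : Ordinal.{u}} (hC : IsClubIn C α)
    (hβα : β < α) (hβ : β ≠ 0) (h : ∀ γ < β, ∃ ξ ∈ C, γ < ξ ∧ ξ < β) : β ∈ C := by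
  refine hC.2.isLUB_mem (t := {ξ : Iio α | (ξ : Ordinal.{u}) ∈ C ∧ (ξ : Ordinal.{u}) < β})
    (x := ⟨β, hβα⟩) (fun ξ hξ => hξ.1) ?_ ⟨fun ξ hξ => hξ.2.le, fun y hy => ?_⟩
  · obtain ⟨ξ, hξ, -, hlt⟩ := h 0 (pos_iff_ne_zero.2 hβ)
    exact ⟨⟨ξ, hlt.trans hβα⟩, hξ, hlt⟩
  · by_contra hlt
    obtain ⟨ξ, hξ, h1, h2⟩ := h y.1 (not_le.1 hlt)
    exact (hy (show (⟨ξ, h2.trans hβα⟩ : Iio α) ∈ _ from ⟨hξ, h2⟩)).not_gt h1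

theorem IsClubIn.unbounded {C : Set Ordinal.{u}} {α γ : Ordinal.{u}} (hC : IsClubIn C α)
    (hα : α ∈ accPoints (Iio κ.ord)) (hγ : γ < α) : ∃ ξ ∈ C, γ < ξ ∧ ξ < α := by
  obtain ⟨δ, -, hγδ, hδα⟩ := hα.2.2 γ hγ
  obtain ⟨ξ, hξ, hle⟩ := hC.2.isCofinal ⟨δ, hδα⟩
  exact ⟨ξ, hξ, hγδ.trans_le hle, ξ.2⟩

theorem isClubIn_image_ordVal {D : Set κ.ord.ToType} (hD : IsCofinal D)
    (hcl : ∀ β, IsLimitPointOf D β → β ∈ D) : IsClubIn (ordVal κ '' D) κ.ord := by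
  refine ⟨?_, fun t ht hne _ x hx => ?_, fun x => ?_⟩
  · rintro _ ⟨a, -, rfl⟩
    exact ordVal_lt_ord a
  -- A supremum of `t` outside `t` is a limit point of `D`.
  · by_cases hxt : x ∈ t
    · exact ht hxt
    obtain ⟨a, ha⟩ := exists_ordVal_eq x.2
    refine ⟨a, hcl a ?_, ha⟩
    rw [← preimage_image_eq D ordVal_injective, isLimitPointOf_preimage_ordVal, ha]
    have hlt : ∀ y ∈ t, y < x := fun y hy => (hx.1 hy).lt_of_ne fun h => hxt (h ▸ hy)
    refine ⟨?_, fun γ hγ => ?_⟩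
    · obtain ⟨y, hy⟩ := hne
      exact (show (y : Ordinal.{u}) < x from hlt y hy).ne_bot
    · obtain ⟨y, hy, hγy⟩ := (lt_isLUB_iff hx).1 (show (⟨γ, hγ.trans x.2⟩ : Iio κ.ord) < x from hγ)
      exact ⟨y, ht hy, hγy, hlt y hy⟩
  · obtain ⟨a, ha⟩ := exists_ordVal_eq x.2
    obtain ⟨b, hb, hab⟩ := hD a
    refine ⟨⟨ordVal κ b, ordVal_lt_ord b⟩, ⟨b, hb, rfl⟩, ?_⟩
    change (x : Ordinal.{u}) ≤ ordVal κ b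
    rw [← ha]
    exact not_lt.1 fun h => (ordVal_lt_ordVal.1 h).not_ge hab

theorem IsSquareSeq.isThreadlessCoherent {C : Ordinal.{u} → Set Ordinal.{u}}
    (hC : IsSquareSeq κ C) : IsThreadlessCoherent fun a => ordVal κ ⁻¹' C (ordVal κ a) where
  subset α hα ξ hξ :=
    ordVal_lt_ordVal.1 ((hC.club _ (ordVal_mem_accPoints.2 hα)).1 hξ)
  unbounded α hα := by
    have h := ordVal_mem_accPoints.2 hα
    exact isLimitPointOf_preimage_ordVal.2 ⟨h.2.1, fun γ hγ => (hC.club _ h).unbounded h hγ⟩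
  coherent α hα β hβ hl := by
    have h := ordVal_mem_accPoints.2 hα
    have hl' := isLimitPointOf_preimage_ordVal.1 hl
    have hβα := ordVal_lt_ordVal.2 hβ
    -- `accPoints` demands membership while `IsLimitPointOf` does not; closedness of the club
    -- bridges the gap.
    have hmem := (hC.club _ h).mem_of_unbounded hβα hl'.1 hl'.2
    have hβlim : ordVal κ β ∈ accPoints (Iio κ.ord) := ordVal_mem_accPoints.2
      ⟨hl.1, fun γ hγ => (hl.2 γ hγ).imp fun _ h => ⟨mem_univ _, h.2⟩⟩
    refine ⟨hmem, ?_⟩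
    rw [← hC.coherent _ hβlim _ h ⟨hmem, hl'⟩]
    ext ξ
    simp [ordVal_lt_ordVal]
  no_thread := by
    rintro ⟨D, hD, hDC⟩
    refine hC.no_thread ⟨ordVal κ '' D, isClubIn_image_ordVal hD fun β hβ => (hDC β hβ).1, ?_⟩
    rintro _ ⟨⟨β, hβ, rfl⟩, hacc⟩
    have hl : IsLimitPointOf D β := by
      rw [← preimage_image_eq D ordVal_injective]
      exact isLimitPointOf_preimage_ordVal.2 hacc
    have hβlim : ordVal κ β ∈ accPoints (Iio κ.ord) := ordVal_mem_accPoints.2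
      ⟨hl.1, fun γ hγ => (hl.2 γ hγ).imp fun _ h => ⟨mem_univ _, h.2⟩⟩
    have hsub := (hC.club _ hβlim).1
    have heq := (hDC β hl).2
    ext o
    constructor
    · rintro ⟨⟨ξ, hξ, rfl⟩, hlt⟩
      exact (heq ▸ ⟨hξ, ordVal_lt_ordVal.1 hlt⟩ : ξ ∈ ordVal κ ⁻¹' C (ordVal κ β))
    · intro ho
      obtain ⟨ξ, rfl⟩ := exists_ordVal_eq ((hsub ho).trans (ordVal_lt_ord β))
      exact ⟨⟨ξ, (heq.symm ▸ ho : ξ ∈ D ∩ Iio β).1, rfl⟩, hsub ho⟩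

end Transfer

theorem theorem1p6 (κ : Cardinal.{u}) (hreg : κ.IsRegular) (hunc : ℵ₀ < κ)
    (h : ∀ (P : Type u) [PartialOrder P], IsKnaster κ P → IsStationarilyLayered κ P) :
    ¬ SquarePrinciple κ := by
  rintro ⟨C, hC⟩
  have : NoMaxOrder κ.ord.ToType := Cardinal.noMaxOrder hreg.aleph0_le
  have : Nonempty κ.ord.ToType := Ordinal.nonempty_toType_iff.2 hreg.ord_pos.ne'
  obtain ⟨P, _, hP, hnot⟩ := hC.isThreadlessCoherent.exists_isKnaster_not_layered hunc
    (Cardinal.mk_ord_toType κ) ((Ordinal.cof_toType _).trans hreg.cof_ord)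
    fun a => by simpa using Cardinal.mk_Iio_lt a (by simp)
  exact hnot (h P hP)
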